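/- Let $\mathbb K$ be $\mathbb R$ or $\mathbb C$, let $X$ be either $\ell_p$ with $1\le p<\infty$ or $c_0$ (sequences in $\mathbb K$ indexed by the non-negative integers), and let $\{e_n\}_{n\ge 0}$ be the canonical basis of $X$. Let $w=\{w_n\}_{n\ge 1}$ be a bounded sequence of non-zero numbers in $\mathbb K$, and let $T$ be the backward weighted shift on $X$ with weight sequence $w$, that is, the bounded linear operator with $Te_0=0$ and $Te_n=w_ne_{n-1}$ for $n\ge 1$. Assume that there exists $c>0$ such that $|w_n|\ge c/n$ for every $n\ge 1$. Then $I+T$ satisfies the Kitai Criterion: there exist dense subsets $E$ and $F$ of $X$ and a map $S:F\to F$ such that $(I+T)Sy=y$, $S^ky\to 0$ and $(I+T)^kx\to 0$ as $k\to\infty$ for all $y\in F$ and $x\in E$. -/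

import Mathlib

open Filter Topology
open scoped ENNReal ZeroAtInfty

/-- A bounded linear operator `T` on a normed space satisfies the Kitai Criterion: there are dense
sets `E`, `F` and a (not necessarily linear or continuous) map `S : F → F` with `T S y = y`,
`S ^ k y → 0` and `T ^ k x → 0` for all `y ∈ F`, `x ∈ E`. -/
def SatisfiesKitaiCriterion {𝕜 X : Type*} [NontriviallyNormedField 𝕜] [NormedAddCommGroup X]
    [NormedSpace 𝕜 X] (T : X →L[𝕜] X) : Prop :=
  ∃ (E F : Set X) (S : F → F), Dense E ∧ Dense F ∧
    (∀ y : F, T (S y) = y) ∧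
    (∀ y : F, Tendsto (fun k : ℕ => (S^[k] y : X)) atTop (𝓝 0)) ∧
    (∀ x ∈ E, Tendsto (fun k : ℕ => (T ^ k) x) atTop (𝓝 0))

/-- `T` is the backward weighted shift with respect to the basis `e 0, e 1, …` and with weights
`w 1, w 2, …` (the value `w 0` plays no role): the weights are bounded and non-zero,
`T e₀ = 0` and `T eₙ = wₙ eₙ₋₁` for `n ≥ 1`. -/
structure IsBackwardWeightedShift {𝕜 X : Type*} [NontriviallyNormedField 𝕜]
    [NormedAddCommGroup X] [NormedSpace 𝕜 X] (e : ℕ → X) (w : ℕ → 𝕜) (T : X →L[𝕜] X) : Prop where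
  weight_bounded : ∃ C : ℝ, ∀ n : ℕ, 1 ≤ n → ‖w n‖ ≤ C
  weight_ne_zero : ∀ n : ℕ, 1 ≤ n → w n ≠ 0
  apply_zero : T (e 0) = 0
  apply_basis : ∀ n : ℕ, 1 ≤ n → T (e n) = w n • e (n - 1)

/-- The canonical basis of `ℓ_p`, the space `lp (fun _ : ℕ => 𝕜) p`. -/
noncomputable def lpBasis (𝕜 : Type*) [RCLike 𝕜] (p : ℝ≥0∞) (n : ℕ) : lp (fun _ : ℕ => 𝕜) p :=
  lp.single p n (1 : 𝕜)

/-- The canonical basis of `c₀`, realised as the space `C₀(ℕ, 𝕜)` of functions on the discrete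
space `ℕ` which tend to zero at infinity, with the supremum norm. -/
noncomputable def c0Basis (𝕜 : Type*) [RCLike 𝕜] (n : ℕ) : C₀(ℕ, 𝕜) where
  toFun := Pi.single n (1 : 𝕜)
  continuous_toFun := continuous_of_discreteTopology
  zero_at_infty' := by
    rw [Filter.cocompact_eq_cofinite]
    refine tendsto_nhds_of_eventually_eq ?_
    refine (Set.finite_singleton n).subset fun m hm => ?_
    by_contra h
    exact hm (Pi.single_eq_of_ne h 1)

/-!
Let `V` be the Volterra operator `(V f) s = ∫ t in s..a, f t`. After rescaling the basis to
vectors `v n` with `T (v (n + 1)) = (n + 1)⁻¹ • v n`, the map `A f = ∫ t in 0..a, f t • y t` along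
the curve `y t = ∑' n, t ^ n • v n` satisfies `T ∘ A = A ∘ V`, because `T ∘ y` is a primitive of
`y` vanishing at `0`; the bound `‖w n‖ ≥ c / n` makes the series converge for `t < c`. The curve
built from `-T` gives likewise `B` with `T ∘ B = -B ∘ V`. So `1 + T` acts as `1 - V` through `B`
and as `1 + V` through `A`, and it suffices that `V (1 - V) ^ k` and `V (1 + V)⁻¹ ^ k` tend to zero
pointwise in `L²`.

With `M` the multiplication by `exp`, one has `(1 + V)⁻¹ = M (1 - V) M⁻¹`, so the two claims are
equivalent. The second one is an energy argument:
`‖f + V f‖² = ‖f‖² + ‖V f‖² + |V f 0|²` shows that `(1 + V)⁻¹` is contractive and dissipates at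
least the energy `‖V (1 + V)⁻¹ f‖²`.

The ranges of `A ∘ V` and `B ∘ V` are dense because the ratio of the moments `∫ t ^ n V ^ k 1` of
order `n > j` to the one of order `j` tends to zero as `k → ∞`, so that `v 0, v 1, …` can be
extracted one after the other from the vectors `A (V ^ k 1) = ∑' n, (∫ t ^ n V ^ k 1) • v n`.
-/

theorem satisfiesKitaiCriterion_of_factorsThrough {𝕜 X H : Type*} [NontriviallyNormedField 𝕜]
    [NormedAddCommGroup X] [NormedSpace 𝕜 X] {T : X →L[𝕜] X} {E : Set X} (hE : Dense E)
    (hTE : ∀ x ∈ E, Tendsto (fun k : ℕ => (T ^ k) x) atTop (𝓝 0)) {Φ : H → X} {R : H → H}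
    (hΦ : DenseRange Φ) (hfac : (Φ ∘ R).FactorsThrough Φ) (hTR : ∀ f, T (Φ (R f)) = Φ f)
    (hR : ∀ f, Tendsto (fun k : ℕ => Φ (R^[k] f)) atTop (𝓝 0)) :
    SatisfiesKitaiCriterion T := by
  obtain ⟨S, hS⟩ : ∃ S : Set.range Φ → Set.range Φ,
      ∀ f, S (Set.rangeFactorization Φ f) = Set.rangeFactorization Φ (R f) := by
    refine ⟨fun y => Set.rangeFactorization Φ (R y.2.choose), fun f => Subtype.ext ?_⟩
    exact hfac (Set.rangeFactorization Φ f).2.choose_spec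
  have hiter (k : ℕ) (f : H) :
      S^[k] (Set.rangeFactorization Φ f) = Set.rangeFactorization Φ (R^[k] f) :=
    (Function.Semiconj.iterate_right (fun g => (hS g).symm) k f).symm
  refine ⟨E, Set.range Φ, S, hE, hΦ, ?_, ?_, hTE⟩
  · rintro ⟨_, f, rfl⟩
    exact (congrArg (fun y => T y) (congrArg Subtype.val (hS f))).trans (hTR f)
  · rintro ⟨_, f, rfl⟩
    refine (hR f).congr fun k => ?_
    exact (congrArg Subtype.val (hiter k f)).symm

theorem IsBackwardWeightedShift.neg {𝕜 X : Type*} [NontriviallyNormedField 𝕜]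
    [NormedAddCommGroup X] [NormedSpace 𝕜 X] {e : ℕ → X} {w : ℕ → 𝕜} {T : X →L[𝕜] X}
    (hT : IsBackwardWeightedShift e w T) :
    IsBackwardWeightedShift e (-w) (-T) where
  weight_bounded := by simpa only [Pi.neg_apply, norm_neg] using hT.weight_bounded
  weight_ne_zero n hn := neg_ne_zero.2 (hT.weight_ne_zero n hn)
  apply_zero := by rw [neg_apply, hT.apply_zero, neg_zero]
  apply_basis n hn := by
    rw [neg_apply, hT.apply_basis n hn, Pi.neg_apply, neg_smul]

/-- By strong induction on `j`: once the terms before `j` are subtracted, dividing by the `j`-th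
coefficient leaves `u j` in the limit `k → ∞`. -/
theorem mem_of_hasSum_of_dominant_coeff {𝕜 X : Type*} [NormedField 𝕜]
    [NormedAddCommGroup X] [NormedSpace 𝕜 X] {M : Submodule 𝕜 X} (hM : IsClosed (M : Set X))
    {u : ℕ → X} {r : ℕ → ℝ} (hu : Summable fun n => r n * ‖u n‖) {x : ℕ → X} {β : ℕ → ℕ → 𝕜}
    (hx : ∀ k, x k ∈ M) (hsum : ∀ k, HasSum (fun n => β k n • u n) (x k))
    (hβ : ∀ k n, β k n ≠ 0) {ε : ℕ → ℕ → ℝ} (hε : ∀ j, Tendsto (ε j) atTop (𝓝 0))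
    (hdom : ∀ k j n, j < n → ‖β k n‖ ≤ ε j k * ‖β k j‖ * r n) (j : ℕ) : u j ∈ M := by
  induction j using Nat.strong_induction_on with
  | _ j ih =>
  have hlead (k : ℕ) :
      ‖(β k j)⁻¹ • (x k - ∑ n ∈ Finset.range j, β k n • u n) - u j‖ ≤
        ε j k * ∑' n, r (n + (j + 1)) * ‖u (n + (j + 1))‖ := by
    have htail := ((hasSum_nat_add_iff' (j + 1)).2 (hsum k)).const_smul (β k j)⁻¹
    rw [Finset.sum_range_succ, ← sub_sub, smul_sub, inv_smul_smul₀ (hβ k j)] at htail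
    rw [← htail.tsum_eq, ← tsum_mul_left]
    refine tsum_of_norm_bounded
      (((summable_nat_add_iff (j + 1)).2 hu).mul_left _).hasSum fun n => ?_
    have hn := hdom k j (n + (j + 1)) (by omega)
    rw [norm_smul, norm_smul, norm_inv]
    calc
      _ ≤ ‖β k j‖⁻¹ * (ε j k * ‖β k j‖ * r (n + (j + 1)) * ‖u (n + (j + 1))‖) := by gcongr
      _ = _ := by
        have := norm_ne_zero_iff.2 (hβ k j)
        field_simp
  have hlim : Tendsto (fun k => (β k j)⁻¹ • (x k - ∑ n ∈ Finset.range j, β k n • u n)) atTop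
      (𝓝 (u j)) :=
    tendsto_iff_norm_sub_tendsto_zero.2
      (squeeze_zero (fun k => norm_nonneg _) hlead (by simpa using (hε j).mul_const _))
  exact hM.mem_of_tendsto hlim (Eventually.of_forall fun k => M.smul_mem _ <|
    M.sub_mem (hx k) (M.sum_mem fun n hn => M.smul_mem _ (ih n (Finset.mem_range.1 hn))))

theorem tendsto_dissipation_zero {H : Type*} {N D : H → ℝ} {R : H → H} (hN : ∀ f, 0 ≤ N f)
    (hD : ∀ f, 0 ≤ D f) (hNR : ∀ f, N (R f) + D f ≤ N f) (f : H) :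
    Tendsto (fun k : ℕ => D (R^[k] f)) atTop (𝓝 0) := by
  have hstep (k : ℕ) : D (R^[k] f) ≤ N (R^[k] f) - N (R^[k + 1] f) := by
    rw [Function.iterate_succ_apply']
    linarith [hNR (R^[k] f)]
  have hanti : Antitone fun k => N (R^[k] f) :=
    antitone_nat_of_succ_le fun k => by linarith [hstep k, hD (R^[k] f)]
  have hlim := tendsto_atTop_ciInf hanti ⟨0, Set.forall_mem_range.2 fun k => hN _⟩
  have hdiff := hlim.sub (hlim.comp (tendsto_add_atTop_nat 1))
  rw [sub_self] at hdiff
  exact squeeze_zero (fun k => hD _) hstep hdiff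

section Volterra

variable {𝕜 : Type*} [RCLike 𝕜]

theorem hasDerivAt_integral_left {E : Type*} [NormedAddCommGroup E] [NormedSpace ℝ E]
    [CompleteSpace E] {f : ℝ → E} (hf : Continuous f) (a s : ℝ) :
    HasDerivAt (fun s => ∫ t in s..a, f t) (-f s) s :=
  intervalIntegral.integral_hasDerivAt_left (hf.intervalIntegrable _ _)
    hf.aestronglyMeasurable.stronglyMeasurableAtFilter hf.continuousAt

/-- The Volterra operator `f ↦ (s ↦ ∫ t in s..a, f t)`. It acts on continuous functions on all of
`ℝ`, so that no endpoint derivatives occur, but only their values on `[0, a]` matter. -/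
noncomputable def volterra (𝕜 : Type*) [RCLike 𝕜] (a : ℝ) : Module.End 𝕜 C(ℝ, 𝕜) where
  toFun f := ⟨fun s => ∫ t in s..a, f t,
    continuous_iff_continuousAt.2 fun s => (hasDerivAt_integral_left f.continuous a s).continuousAt⟩
  map_add' f g := ContinuousMap.ext fun _ => intervalIntegral.integral_add
    (f.continuous.intervalIntegrable _ _) (g.continuous.intervalIntegrable _ _)
  map_smul' c f := ContinuousMap.ext fun _ => intervalIntegral.integral_smul c f

theorem hasDerivAt_volterra (a : ℝ) (f : C(ℝ, 𝕜)) (s : ℝ) :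
    HasDerivAt (volterra 𝕜 a f) (-f s) s :=
  hasDerivAt_integral_left f.continuous a s

theorem volterra_apply_self (a : ℝ) (f : C(ℝ, 𝕜)) : volterra 𝕜 a f a = 0 :=
  intervalIntegral.integral_same

theorem eq_volterra_of_hasDerivAt {a : ℝ} {f g : C(ℝ, 𝕜)}
    (hg : ∀ s, HasDerivAt g (-f s) s) (ha : g a = 0) : g = volterra 𝕜 a f := by
  ext s
  have h := intervalIntegral.integral_eq_sub_of_hasDerivAt (a := s) (b := a)
    (fun t _ => hg t) (f.continuous.neg.intervalIntegrable _ _)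
  rw [intervalIntegral.integral_neg, ha, zero_sub, neg_inj] at h
  exact h.symm

/-- Multiplication by the function `t ↦ exp (r * t)`. -/
noncomputable def expMul (𝕜 : Type*) [RCLike 𝕜] (r : ℝ) : Module.End 𝕜 C(ℝ, 𝕜) where
  toFun f := ⟨fun t => Real.exp (r * t) • f t, by fun_prop⟩
  map_add' _ _ := ContinuousMap.ext fun _ => smul_add _ _ _
  map_smul' c f := ContinuousMap.ext fun t => smul_comm (Real.exp (r * t)) c (f t)

theorem expMul_apply (r : ℝ) (f : C(ℝ, 𝕜)) (t : ℝ) :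
    expMul 𝕜 r f t = Real.exp (r * t) • f t := rfl

theorem expMul_mul_expMul_neg (r : ℝ) : expMul 𝕜 r * expMul 𝕜 (-r) = 1 := by
  ext f t
  simp [expMul_apply, smul_smul, ← Real.exp_add]

/-- `expMul 𝕜 1` as a unit of the algebra of operators. -/
noncomputable def expUnit (𝕜 : Type*) [RCLike 𝕜] : (Module.End 𝕜 C(ℝ, 𝕜))ˣ where
  val := expMul 𝕜 1
  inv := expMul 𝕜 (-1)
  val_inv := expMul_mul_expMul_neg 1
  inv_val := by simpa using expMul_mul_expMul_neg (𝕜 := 𝕜) (-1)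

theorem expMul_mul_volterra (r a : ℝ) :
    expMul 𝕜 r * volterra 𝕜 a =
      volterra 𝕜 a * expMul 𝕜 r * (1 - (r : 𝕜) • volterra 𝕜 a) := by
  refine LinearMap.ext fun f => eq_volterra_of_hasDerivAt (fun s => ?_) ?_
  · have hexp : HasDerivAt (fun t => Real.exp (r * t)) (Real.exp (r * s) * (r * 1)) s :=
      ((hasDerivAt_id s).const_mul r).exp
    refine HasDerivAt.congr_deriv (hexp.smul (hasDerivAt_volterra a f s)) ?_
    simp only [expMul_apply, LinearMap.sub_apply, LinearMap.smul_apply, Module.End.one_apply,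
      ContinuousMap.sub_apply, ContinuousMap.smul_apply, RCLike.real_smul_eq_coe_mul,
      smul_eq_mul, RCLike.ofReal_mul]
    push_cast
    ring
  · simp [expMul_apply, volterra_apply_self]

/-- The inverse of `1 + volterra 𝕜 a`, obtained by conjugating `1 - volterra 𝕜 a` with
multiplication by the exponential function. -/
noncomputable def volterraResolvent (𝕜 : Type*) [RCLike 𝕜] (a : ℝ) : Module.End 𝕜 C(ℝ, 𝕜) :=
  expUnit 𝕜 * (1 - volterra 𝕜 a) * ↑(expUnit 𝕜)⁻¹

theorem volterra_mul_volterraResolvent (a : ℝ) :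
    volterra 𝕜 a * volterraResolvent 𝕜 a =
      expUnit 𝕜 * volterra 𝕜 a * ↑(expUnit 𝕜)⁻¹ := by
  have h : ↑(expUnit 𝕜) * volterra 𝕜 a = volterra 𝕜 a * expUnit 𝕜 * (1 - volterra 𝕜 a) := by
    have h := expMul_mul_volterra (𝕜 := 𝕜) 1 a
    rwa [RCLike.ofReal_one, one_smul] at h
  rw [volterraResolvent, h]
  noncomm_ring

theorem one_add_volterra_mul_volterraResolvent (a : ℝ) :
    (1 + volterra 𝕜 a) * volterraResolvent 𝕜 a = 1 := by
  have hsum : 1 - volterra 𝕜 a + volterra 𝕜 a = 1 :=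
    LinearMap.ext fun f => sub_add_cancel f (volterra 𝕜 a f)
  rw [add_mul, one_mul, volterra_mul_volterraResolvent, volterraResolvent, ← add_mul, ← mul_add,
    hsum, mul_one, Units.mul_inv]

theorem volterra_mul_one_sub_volterra_pow (a : ℝ) (k : ℕ) :
    volterra 𝕜 a * (1 - volterra 𝕜 a) ^ k =
      ↑(expUnit 𝕜)⁻¹ * (volterra 𝕜 a * volterraResolvent 𝕜 a * volterraResolvent 𝕜 a ^ k) *
        expUnit 𝕜 := by
  rw [volterra_mul_volterraResolvent, volterraResolvent, Units.conj_pow]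
  simp only [mul_assoc, Units.inv_mul, Units.inv_mul_cancel_left, mul_one]

/-- The square of the `L²` norm on `[0, a]`. -/
noncomputable def l2NormSq (a : ℝ) (f : C(ℝ, 𝕜)) : ℝ :=
  ∫ t in 0..a, ‖f t‖ ^ 2

theorem l2NormSq_nonneg {a : ℝ} (ha : 0 ≤ a) (f : C(ℝ, 𝕜)) : 0 ≤ l2NormSq a f :=
  intervalIntegral.integral_nonneg ha fun _ _ => by positivity

theorem l2NormSq_mono {a : ℝ} (ha : 0 ≤ a) {f g : C(ℝ, 𝕜)}
    (hfg : ∀ t ∈ Set.Icc 0 a, ‖f t‖ ≤ ‖g t‖) : l2NormSq a f ≤ l2NormSq a g :=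
  intervalIntegral.integral_mono_on ha (Continuous.intervalIntegrable (by fun_prop) _ _)
    (Continuous.intervalIntegrable (by fun_prop) _ _) fun t ht => by
      gcongr
      exact hfg t ht

theorem sq_integral_norm_le_mul_l2NormSq {a : ℝ} (ha : 0 < a) (f : C(ℝ, 𝕜)) :
    (∫ t in 0..a, ‖f t‖) ^ 2 ≤ a * l2NormSq a f := by
  set m := ∫ t in 0..a, ‖f t‖ with hm
  have hint {g : ℝ → ℝ} (hg : Continuous g) : IntervalIntegrable g MeasureTheory.volume 0 a :=
    hg.intervalIntegrable _ _
  have hvar : ∫ t in 0..a, (‖f t‖ - m / a) ^ 2 = l2NormSq a f - m ^ 2 / a := by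
    have hexpand (t : ℝ) : (‖f t‖ - m / a) ^ 2 =
        ‖f t‖ ^ 2 - 2 * (m / a) * ‖f t‖ + (m / a) ^ 2 := by ring
    simp_rw [hexpand]
    rw [intervalIntegral.integral_add (hint (by fun_prop)) (hint (by fun_prop)),
      intervalIntegral.integral_sub (hint (by fun_prop)) (hint (by fun_prop)),
      intervalIntegral.integral_const_mul, intervalIntegral.integral_const, ← hm, ← l2NormSq,
      smul_eq_mul]
    field_simp
    ring
  have hnonneg : 0 ≤ l2NormSq a f - m ^ 2 / a :=
    hvar ▸ intervalIntegral.integral_nonneg ha.le fun _ _ => sq_nonneg _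
  rw [sub_nonneg, div_le_iff₀ ha] at hnonneg
  linarith

theorem l2NormSq_add_volterra (a : ℝ) (f : C(ℝ, 𝕜)) :
    l2NormSq a (f + volterra 𝕜 a f) =
      l2NormSq a f + l2NormSq a (volterra 𝕜 a f) + ‖volterra 𝕜 a f 0‖ ^ 2 := by
  set u := volterra 𝕜 a f
  have hint (g : C(ℝ, 𝕜)) : IntervalIntegrable (‖g ·‖ ^ 2) MeasureTheory.volume 0 a :=
    Continuous.intervalIntegrable (by fun_prop) _ _
  have hderiv (t : ℝ) :
      HasDerivAt (‖u ·‖ ^ 2) (‖f t‖ ^ 2 + ‖u t‖ ^ 2 - ‖(f + u) t‖ ^ 2) t := by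
    refine (hasDerivAt_volterra a f t).norm_sq.congr_deriv ?_
    rw [ContinuousMap.add_apply, norm_add_sq_real, inner_neg_right, real_inner_comm]
    ring
  have h := intervalIntegral.integral_eq_sub_of_hasDerivAt (a := 0) (b := a)
    (fun t _ => hderiv t) (((hint f).add (hint u)).sub (hint _))
  rw [intervalIntegral.integral_sub ((hint f).add (hint u)) (hint _),
    intervalIntegral.integral_add (hint f) (hint u), volterra_apply_self] at h
  simp only [norm_zero, ne_eq, OfNat.ofNat_ne_zero, not_false_eq_true, zero_pow, zero_sub] at h
  simp only [l2NormSq]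
  linarith

theorem tendsto_l2NormSq_volterra_volterraResolvent_pow {a : ℝ} (ha : 0 ≤ a) (f : C(ℝ, 𝕜)) :
    Tendsto (fun k : ℕ => l2NormSq a
      ((volterra 𝕜 a * volterraResolvent 𝕜 a * volterraResolvent 𝕜 a ^ k) f)) atTop (𝓝 0) := by
  have hdissip (g : C(ℝ, 𝕜)) : l2NormSq a (volterraResolvent 𝕜 a g) +
      l2NormSq a ((volterra 𝕜 a * volterraResolvent 𝕜 a) g) ≤ l2NormSq a g := by
    have hg : volterraResolvent 𝕜 a g + volterra 𝕜 a (volterraResolvent 𝕜 a g) = g :=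
      LinearMap.congr_fun (one_add_volterra_mul_volterraResolvent a) g
    have henergy := l2NormSq_add_volterra a (volterraResolvent 𝕜 a g)
    rw [hg] at henergy
    rw [Module.End.mul_apply, henergy]
    exact le_add_of_nonneg_right (by positivity)
  simpa only [← Module.End.pow_apply, ← Module.End.mul_apply] using
    tendsto_dissipation_zero (l2NormSq_nonneg ha) (fun g => l2NormSq_nonneg ha _) hdissip f

theorem tendsto_l2NormSq_volterra_one_sub_volterra_pow {a : ℝ} (ha : 0 ≤ a) (f : C(ℝ, 𝕜)) :
    Tendsto (fun k : ℕ => l2NormSq a ((volterra 𝕜 a * (1 - volterra 𝕜 a) ^ k) f))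
      atTop (𝓝 0) := by
  refine squeeze_zero (fun k => l2NormSq_nonneg ha _) (fun k => ?_)
    (tendsto_l2NormSq_volterra_volterraResolvent_pow ha (expMul 𝕜 1 f))
  rw [volterra_mul_one_sub_volterra_pow]
  refine l2NormSq_mono ha fun t ht => ?_
  change ‖expMul 𝕜 (-1) _ t‖ ≤ _
  rw [expMul_apply, norm_smul, Real.norm_eq_abs, Real.abs_exp]
  exact mul_le_of_le_one_left (norm_nonneg _) (Real.exp_le_one_iff.2 (by linarith [ht.1]))

end Volterra

section Moments

variable {𝕜 : Type*} [RCLike 𝕜] {a : ℝ}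

/-- The `n`-th moment `∫ t in 0..a, t ^ n • f t` of `f` on `[0, a]`. -/
noncomputable def moment (𝕜 : Type*) [RCLike 𝕜] (a : ℝ) (n : ℕ) : C(ℝ, 𝕜) →ₗ[𝕜] 𝕜 where
  toFun f := ∫ t in 0..a, t ^ n • f t
  map_add' f g := by
    simp only [ContinuousMap.add_apply, smul_add]
    exact intervalIntegral.integral_add (Continuous.intervalIntegrable (by fun_prop) _ _)
      (Continuous.intervalIntegrable (by fun_prop) _ _)
  map_smul' c f := by
    simp only [ContinuousMap.smul_apply, smul_comm _ c]
    exact intervalIntegral.integral_smul c _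

theorem moment_apply (a : ℝ) (n : ℕ) (f : C(ℝ, 𝕜)) :
    moment 𝕜 a n f = ∫ t in 0..a, t ^ n • f t := rfl

theorem moment_volterra (a : ℝ) (n : ℕ) (f : C(ℝ, 𝕜)) :
    moment 𝕜 a n (volterra 𝕜 a f) = (n + 1 : 𝕜)⁻¹ * moment 𝕜 a (n + 1) f := by
  have hderiv (t : ℝ) : HasDerivAt (fun t => t ^ (n + 1) • volterra 𝕜 a f t)
      ((n + 1 : 𝕜) • t ^ n • volterra 𝕜 a f t - t ^ (n + 1) • f t) t := by
    refine ((hasDerivAt_pow (n + 1) t).smul (hasDerivAt_volterra a f t)).congr_deriv ?_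
    simp only [RCLike.real_smul_eq_coe_mul, smul_eq_mul, add_tsub_cancel_right]
    push_cast
    ring
  have h := intervalIntegral.integral_eq_sub_of_hasDerivAt (a := 0) (b := a)
    (fun t _ => hderiv t) (Continuous.intervalIntegrable (by fun_prop) _ _)
  rw [intervalIntegral.integral_sub (Continuous.intervalIntegrable (by fun_prop) _ _)
      (Continuous.intervalIntegrable (by fun_prop) _ _), intervalIntegral.integral_smul,
    ← moment_apply, ← moment_apply, volterra_apply_self, smul_zero, zero_pow n.succ_ne_zero,
    zero_smul, sub_zero, sub_eq_zero] at h
  rw [← h, smul_eq_mul, inv_mul_cancel_left₀ (Nat.cast_add_one_ne_zero n)]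

theorem moment_one (a : ℝ) (n : ℕ) : moment 𝕜 a n 1 = (a ^ (n + 1) / (n + 1) : ℝ) := by
  simp only [moment_apply, ContinuousMap.one_apply]
  rw [intervalIntegral.integral_smul_const, integral_pow, zero_pow n.succ_ne_zero, sub_zero,
    RCLike.real_smul_eq_coe_mul, mul_one]

theorem norm_moment_volterra_pow_one (ha : 0 ≤ a) (n k : ℕ) :
    ‖moment 𝕜 a n ((volterra 𝕜 a ^ k) 1)‖ =
      a ^ (n + k + 1) * ((n.factorial : ℝ) / (n + k + 1).factorial) := by
  induction k generalizing n with
  | zero =>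
    rw [pow_zero, Module.End.one_apply, moment_one, RCLike.norm_ofReal,
      abs_of_nonneg (by positivity), add_zero, Nat.factorial_succ]
    push_cast
    field_simp
  | succ k ih =>
    have hn : ‖(n + 1 : 𝕜)‖ = n + 1 := by
      exact_mod_cast RCLike.norm_natCast (K := 𝕜) (n + 1)
    rw [pow_succ', Module.End.mul_apply, moment_volterra, norm_mul, norm_inv, hn, ih,
      Nat.factorial_succ, show n + 1 + k = n + (k + 1) by ring]
    push_cast
    field_simp

theorem norm_moment_le (ha : 0 ≤ a) (n : ℕ) (f : C(ℝ, 𝕜)) :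
    ‖moment 𝕜 a n f‖ ≤ a ^ n * ∫ t in 0..a, ‖f t‖ := by
  rw [moment_apply, ← intervalIntegral.integral_const_mul]
  refine (intervalIntegral.norm_integral_le_integral_norm ha).trans
    (intervalIntegral.integral_mono_on ha (Continuous.intervalIntegrable (by fun_prop) _ _)
      (Continuous.intervalIntegrable (by fun_prop) _ _) fun t ht => ?_)
  rw [norm_smul, norm_pow, Real.norm_of_nonneg ht.1]
  gcongr
  exacts [ht.1, ht.2]

theorem factorial_div_factorial_add_le {j n : ℕ} (m : ℕ) (hjn : j < n) :
    (n.factorial : ℝ) / (n + m).factorial ≤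
      (j + 1) / (j + 1 + m) * (j.factorial / (j + m).factorial) := by
  have hsucc (i : ℕ) : ((i + 1).factorial : ℝ) / (i + 1 + m).factorial =
      (i + 1) / (i + 1 + m) * (i.factorial / (i + m).factorial) := by
    rw [Nat.factorial_succ, show i + 1 + m = i + m + 1 by ring, Nat.factorial_succ]
    push_cast
    field_simp
    ring
  have hanti : Antitone fun i : ℕ => (i.factorial : ℝ) / (i + m).factorial :=
    antitone_nat_of_succ_le fun i => by
      rw [hsucc]
      refine mul_le_of_le_one_left (by positivity) (div_le_one_of_le₀ ?_ (by positivity))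
      linarith [m.cast_nonneg (α := ℝ)]
  exact (hanti hjn).trans_eq (hsucc j)

theorem norm_moment_volterra_pow_one_le (ha : 0 < a) {j n : ℕ} (hjn : j < n) (k : ℕ) :
    ‖moment 𝕜 a n ((volterra 𝕜 a ^ k) 1)‖ ≤
      (j + 1) / (j + k + 2) * (a ^ j)⁻¹ * ‖moment 𝕜 a j ((volterra 𝕜 a ^ k) 1)‖ * a ^ n := by
  have h := factorial_div_factorial_add_le (k + 1) hjn
  simp only [norm_moment_volterra_pow_one ha.le, add_assoc]
  calc
    _ ≤ a ^ (n + (k + 1)) *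
        ((j + 1) / (j + 1 + (k + 1 : ℕ)) * (j.factorial / (j + (k + 1)).factorial)) := by gcongr
    _ = _ := by
      simp only [pow_add]
      push_cast
      field_simp
      ring

end Moments

section VolterraModel

variable {𝕜 X : Type*} [RCLike 𝕜] [NormedAddCommGroup X] [NormedSpace 𝕜 X]

/-- `A` models `T` on the Volterra operator of `[0, a]`: it intertwines the two operators, its
restriction to the range of the Volterra operator has dense range, and it is sequentially continuous
for the `L²` norm. -/
structure IsVolterraModel (a : ℝ) (T : X →L[𝕜] X) (A : C(ℝ, 𝕜) →ₗ[𝕜] X) : Prop where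
  map_apply (f : C(ℝ, 𝕜)) : T (A f) = A (volterra 𝕜 a f)
  denseRange : DenseRange fun f => A (volterra 𝕜 a f)
  tendsto_zero {f : ℕ → C(ℝ, 𝕜)} (hf : Tendsto (fun k => l2NormSq a (f k)) atTop (𝓝 0)) :
    Tendsto (fun k => A (f k)) atTop (𝓝 0)

section MomentSeries

variable [CompleteSpace X] {a : ℝ} {v : ℕ → X}

theorem summable_moment_smul (ha : 0 ≤ a) (hv : Summable fun n => a ^ n * ‖v n‖)
    (f : C(ℝ, 𝕜)) : Summable fun n => moment 𝕜 a n f • v n := by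
  refine .of_norm_bounded (hv.mul_right (∫ t in 0..a, ‖f t‖)) fun n => ?_
  rw [norm_smul, mul_right_comm]
  gcongr
  exact norm_moment_le ha n f

/-- The map `f ↦ ∫ t in 0..a, f t • ∑' n, t ^ n • v n`, integrated termwise. -/
noncomputable def momentSeries (𝕜 : Type*) [RCLike 𝕜] [NormedSpace 𝕜 X] (ha : 0 ≤ a)
    (hv : Summable fun n => a ^ n * ‖v n‖) : C(ℝ, 𝕜) →ₗ[𝕜] X where
  toFun f := ∑' n, moment 𝕜 a n f • v n
  map_add' f g := by
    simp only [map_add, add_smul]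
    exact (summable_moment_smul ha hv f).tsum_add (summable_moment_smul ha hv g)
  map_smul' c f := by
    simp only [map_smul, smul_assoc]
    exact (summable_moment_smul ha hv f).tsum_const_smul c

theorem hasSum_momentSeries (ha : 0 ≤ a) (hv : Summable fun n => a ^ n * ‖v n‖) (f : C(ℝ, 𝕜)) :
    HasSum (fun n => moment 𝕜 a n f • v n) (momentSeries 𝕜 ha hv f) :=
  (summable_moment_smul ha hv f).hasSum

theorem norm_momentSeries_le (ha : 0 ≤ a) (hv : Summable fun n => a ^ n * ‖v n‖)
    (f : C(ℝ, 𝕜)) :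
    ‖momentSeries 𝕜 ha hv f‖ ≤ (∑' n, a ^ n * ‖v n‖) * ∫ t in 0..a, ‖f t‖ := by
  refine (hasSum_momentSeries ha hv f).norm_le_of_bounded (hv.hasSum.mul_right _) fun n => ?_
  rw [norm_smul, mul_right_comm]
  gcongr
  exact norm_moment_le ha n f

theorem tendsto_momentSeries_zero (ha : 0 < a) (hv : Summable fun n => a ^ n * ‖v n‖)
    {f : ℕ → C(ℝ, 𝕜)} (hf : Tendsto (fun k => l2NormSq a (f k)) atTop (𝓝 0)) :
    Tendsto (fun k => momentSeries 𝕜 ha.le hv (f k)) atTop (𝓝 0) := by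
  have hint : Tendsto (fun k => ∫ t in 0..a, ‖f k t‖) atTop (𝓝 0) := by
    refine squeeze_zero
      (fun k => intervalIntegral.integral_nonneg ha.le fun _ _ => norm_nonneg _)
      (fun k => Real.le_sqrt_of_sq_le (sq_integral_norm_le_mul_l2NormSq ha (f k))) ?_
    simpa using (hf.const_mul a).sqrt
  exact squeeze_zero_norm (fun k => norm_momentSeries_le ha.le hv (f k))
    (by simpa using hint.const_mul (∑' n, a ^ n * ‖v n‖))

theorem map_momentSeries {T : X →L[𝕜] X} (hT₀ : T (v 0) = 0)
    (hT : ∀ n : ℕ, T (v (n + 1)) = (n + 1 : 𝕜)⁻¹ • v n) (ha : 0 ≤ a)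
    (hv : Summable fun n => a ^ n * ‖v n‖) (f : C(ℝ, 𝕜)) :
    T (momentSeries 𝕜 ha hv f) = momentSeries 𝕜 ha hv (volterra 𝕜 a f) := by
  have hTsum := (hasSum_nat_add_iff' 1).2 (T.hasSum (hasSum_momentSeries ha hv f))
  simp only [Finset.sum_range_one, map_smul, hT₀, hT, smul_zero, sub_zero] at hTsum
  refine hTsum.unique ?_
  simpa only [moment_volterra, smul_smul, mul_comm] using
    hasSum_momentSeries ha hv (volterra 𝕜 a f)

theorem denseRange_momentSeries_volterra (ha : 0 < a) (hv : Summable fun n => a ^ n * ‖v n‖)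
    (hspan : Dense (Submodule.span 𝕜 (Set.range v) : Set X)) :
    DenseRange fun f => momentSeries 𝕜 ha.le hv (volterra 𝕜 a f) := by
  set M := (momentSeries 𝕜 ha.le hv ∘ₗ volterra 𝕜 a).range
  suffices hmem : ∀ j, v j ∈ M.topologicalClosure by
    have hle := Submodule.span_le.2 (Set.range_subset_iff.2 hmem)
    exact dense_closure.1 (hspan.mono hle)
  refine mem_of_hasSum_of_dominant_coeff M.isClosed_topologicalClosure hv
    (x := fun k => momentSeries 𝕜 ha.le hv ((volterra 𝕜 a ^ (k + 1)) 1))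
    (ε := fun j k => (j + 1) / (j + (k + 1 : ℕ) + 2) * (a ^ j)⁻¹)
    (fun k => M.le_topologicalClosure ⟨(volterra 𝕜 a ^ k) 1, ?_⟩)
    (fun k => hasSum_momentSeries ha.le hv _) (fun k n => ?_) (fun j => ?_)
    fun k j n hjn => norm_moment_volterra_pow_one_le ha hjn (k + 1)
  · rw [pow_succ', Module.End.mul_apply, LinearMap.comp_apply]
  · rw [← norm_ne_zero_iff, norm_moment_volterra_pow_one ha.le]
    positivity
  · have hden : Tendsto (fun k : ℕ => (j : ℝ) + (k + 1 : ℕ) + 2) atTop atTop :=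
      tendsto_atTop_add_const_right _ _ <| tendsto_atTop_add_const_left _ _ <|
        tendsto_natCast_atTop_atTop.comp (tendsto_add_atTop_nat 1)
    simpa using (hden.const_div_atTop (j + 1 : ℝ)).mul_const (a ^ j)⁻¹

theorem isVolterraModel_momentSeries {T : X →L[𝕜] X} (hT₀ : T (v 0) = 0)
    (hT : ∀ n : ℕ, T (v (n + 1)) = (n + 1 : 𝕜)⁻¹ • v n) (ha : 0 < a)
    (hv : Summable fun n => a ^ n * ‖v n‖)
    (hspan : Dense (Submodule.span 𝕜 (Set.range v) : Set X)) :
    IsVolterraModel a T (momentSeries 𝕜 ha.le hv) where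
  map_apply := map_momentSeries hT₀ hT ha.le hv
  denseRange := denseRange_momentSeries_volterra ha hv hspan
  tendsto_zero := tendsto_momentSeries_zero ha hv

end MomentSeries

end VolterraModel

section Kitai

variable {𝕜 X : Type*} [RCLike 𝕜] [NormedAddCommGroup X] [NormedSpace 𝕜 X] {T : X →L[𝕜] X}

namespace IsVolterraModel

variable {a : ℝ} {A B : C(ℝ, 𝕜) →ₗ[𝕜] X}

theorem apply_one_sub_volterra_pow (hA : IsVolterraModel a T A) (k : ℕ) (f : C(ℝ, 𝕜)) :
    A (((1 - volterra 𝕜 a) ^ k) f) = ((ContinuousLinearMap.id 𝕜 X - T) ^ k) (A f) := by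
  induction k generalizing f with
  | zero => rfl
  | succ k ih =>
    have hf : A ((1 - volterra 𝕜 a) f) = (ContinuousLinearMap.id 𝕜 X - T) (A f) := by
      rw [sub_apply (F := X →L[𝕜] X), hA.map_apply]
      exact map_sub A f (volterra 𝕜 a f)
    rw [pow_succ, pow_succ, Module.End.mul_apply, ih, hf, mul_apply_eq_comp]

theorem tendsto_id_sub_pow (hA : IsVolterraModel a T A) (ha : 0 ≤ a) (f : C(ℝ, 𝕜)) :
    Tendsto (fun k : ℕ => ((ContinuousLinearMap.id 𝕜 X - T) ^ k) (A (volterra 𝕜 a f)))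
      atTop (𝓝 0) := by
  refine (hA.tendsto_zero (tendsto_l2NormSq_volterra_one_sub_volterra_pow ha f)).congr fun k => ?_
  have hcomm : Commute T ((ContinuousLinearMap.id 𝕜 X - T) ^ k) :=
    ((Commute.one_right T).sub_right (Commute.refl T)).pow_right k
  rw [Module.End.mul_apply, ← hA.map_apply, hA.apply_one_sub_volterra_pow, ← hA.map_apply,
    ← mul_apply_eq_comp, hcomm.eq, mul_apply_eq_comp]

theorem tendsto_volterraResolvent_iterate (hA : IsVolterraModel a T A) (ha : 0 ≤ a)
    (f : C(ℝ, 𝕜)) :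
    Tendsto (fun k : ℕ => A (volterra 𝕜 a ((volterraResolvent 𝕜 a)^[k] f))) atTop (𝓝 0) := by
  rw [← tendsto_add_atTop_iff_nat 1]
  refine (hA.tendsto_zero (tendsto_l2NormSq_volterra_volterraResolvent_pow ha f)).congr fun k => ?_
  rw [Function.iterate_succ_apply', ← Module.End.pow_apply]
  rfl

theorem id_add_apply_volterraResolvent (hA : IsVolterraModel a T A) (f : C(ℝ, 𝕜)) :
    (ContinuousLinearMap.id 𝕜 X + T) (A (volterra 𝕜 a (volterraResolvent 𝕜 a f))) =
      A (volterra 𝕜 a f) := by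
  have hf : volterraResolvent 𝕜 a f + volterra 𝕜 a (volterraResolvent 𝕜 a f) = f :=
    LinearMap.congr_fun (one_add_volterra_mul_volterraResolvent a) f
  rw [add_apply, ContinuousLinearMap.id_apply, hA.map_apply, ← map_add,
    ← map_add, hf]

/-- On such a vector `(1 - T) ^ k T` is multiplication by `-2 ^ k`, yet it tends to zero there. -/
theorem apply_eq_zero_of_map_eq_neg (hA : IsVolterraModel a T A) (ha : 0 ≤ a) {f : C(ℝ, 𝕜)}
    (hf : T (A f) = -A f) : A f = 0 := by
  have hpow (k : ℕ) : ((ContinuousLinearMap.id 𝕜 X - T) ^ k) (A f) = (2 : 𝕜) ^ k • A f := by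
    induction k with
    | zero => simp
    | succ k ih =>
      rw [pow_succ', mul_apply_eq_comp, ih, map_smul, sub_apply,
        ContinuousLinearMap.id_apply, hf, sub_neg_eq_add, ← two_smul 𝕜, smul_smul, pow_succ]
  have hlim := (hA.tendsto_id_sub_pow ha f).norm
  simp only [← hA.map_apply, hf, map_neg, hpow, norm_neg, norm_smul, norm_pow, RCLike.norm_two,
    norm_zero] at hlim
  refine norm_le_zero_iff.1 (ge_of_tendsto' hlim fun k => ?_)
  exact le_mul_of_one_le_left (norm_nonneg _) (one_le_pow₀ one_le_two)

theorem factorsThrough_volterraResolvent (hA : IsVolterraModel a T A) (ha : 0 ≤ a) :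
    ((fun f => A (volterra 𝕜 a f)) ∘ volterraResolvent 𝕜 a).FactorsThrough
      fun f => A (volterra 𝕜 a f) := by
  intro f g hfg
  have hker : T (A (volterra 𝕜 a (volterraResolvent 𝕜 a (f - g)))) =
      -A (volterra 𝕜 a (volterraResolvent 𝕜 a (f - g))) := by
    have h := hA.id_add_apply_volterraResolvent (f - g)
    rw [add_apply, ContinuousLinearMap.id_apply] at h
    rw [eq_neg_iff_add_eq_zero, add_comm, h, map_sub, map_sub, sub_eq_zero]
    exact hfg
  have hzero := hA.apply_eq_zero_of_map_eq_neg ha hker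
  rwa [map_sub, map_sub, map_sub, sub_eq_zero] at hzero

theorem satisfiesKitaiCriterion (hA : IsVolterraModel a T A) (hB : IsVolterraModel a (-T) B)
    (ha : 0 ≤ a) : SatisfiesKitaiCriterion (ContinuousLinearMap.id 𝕜 X + T) := by
  refine satisfiesKitaiCriterion_of_factorsThrough hB.denseRange ?_ hA.denseRange
    (hA.factorsThrough_volterraResolvent ha) hA.id_add_apply_volterraResolvent
    (hA.tendsto_volterraResolvent_iterate ha)
  rintro _ ⟨f, rfl⟩
  simpa only [sub_neg_eq_add] using hB.tendsto_id_sub_pow ha f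

end IsVolterraModel

end Kitai

section WeightedShift

variable {𝕜 X : Type*} [RCLike 𝕜] [NormedAddCommGroup X] [NormedSpace 𝕜 X] {e : ℕ → X}
  {w : ℕ → 𝕜} {T : X →L[𝕜] X}

/-- The factors by which to rescale `e` so that the backward weighted shift with weights `w`
acquires the weights `1 / n`. -/
noncomputable def shiftFactor (w : ℕ → 𝕜) (n : ℕ) : 𝕜 :=
  ∏ j ∈ Finset.range n, (((j : 𝕜) + 1) * w (j + 1))⁻¹

theorem shiftFactor_ne_zero (hw : ∀ n, 1 ≤ n → w n ≠ 0) (n : ℕ) : shiftFactor w n ≠ 0 :=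
  Finset.prod_ne_zero_iff.2 fun j _ =>
    inv_ne_zero (mul_ne_zero (Nat.cast_add_one_ne_zero j) (hw _ j.succ_pos))

theorem norm_shiftFactor_le {c : ℝ} (hc : 0 < c) (hw : ∀ n : ℕ, 1 ≤ n → c / (n : ℝ) ≤ ‖w n‖)
    (n : ℕ) : ‖shiftFactor w n‖ ≤ c⁻¹ ^ n := by
  rw [shiftFactor, norm_prod]
  refine (Finset.prod_le_prod (g := fun _ => c⁻¹) (fun _ _ => norm_nonneg _)
    fun j _ => ?_).trans_eq (by rw [Finset.prod_const, Finset.card_range])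
  have h := hw (j + 1) j.succ_pos
  rw [div_le_iff₀' (by positivity)] at h
  have hj : ‖(j : 𝕜) + 1‖ = ((j + 1 : ℕ) : ℝ) := by
    rw [← Nat.cast_add_one, RCLike.norm_natCast]
  rw [norm_inv, norm_mul, hj]
  gcongr

namespace IsBackwardWeightedShift

theorem apply_shiftFactor_smul_succ (hT : IsBackwardWeightedShift e w T) (n : ℕ) :
    T (shiftFactor w (n + 1) • e (n + 1)) = (n + 1 : 𝕜)⁻¹ • shiftFactor w n • e n := by
  have hwn := hT.weight_ne_zero (n + 1) n.succ_pos
  rw [map_smul, hT.apply_basis (n + 1) n.succ_pos, Nat.add_sub_cancel, smul_smul, smul_smul,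
    shiftFactor, Finset.prod_range_succ, ← shiftFactor, mul_inv, mul_assoc,
    inv_mul_cancel_right₀ hwn, mul_comm]

theorem exists_isVolterraModel [CompleteSpace X] (hT : IsBackwardWeightedShift e w T) {K : ℝ}
    (heK : ∀ n, ‖e n‖ ≤ K) (he : Dense (Submodule.span 𝕜 (Set.range e) : Set X)) {a c : ℝ}
    (ha : 0 < a) (hac : a < c) (hw : ∀ n : ℕ, 1 ≤ n → c / (n : ℝ) ≤ ‖w n‖) :
    ∃ A : C(ℝ, 𝕜) →ₗ[𝕜] X, IsVolterraModel a T A := by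
  have hc := ha.trans hac
  have hsum : Summable fun n => a ^ n * ‖shiftFactor w n • e n‖ := by
    refine .of_nonneg_of_le (fun n => by positivity) (fun n => ?_)
      ((summable_geometric_of_lt_one (div_nonneg ha.le hc.le) ((div_lt_one hc).2 hac)).mul_right K)
    rw [norm_smul, div_eq_mul_inv, mul_pow, mul_assoc]
    gcongr
    exacts [norm_shiftFactor_le hc hw n, heK n]
  have hspan : Dense (Submodule.span 𝕜 (Set.range fun n => shiftFactor w n • e n) : Set X) := by
    refine he.mono (Submodule.span_le.2 (Set.range_subset_iff.2 fun n => ?_))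
    have hn := shiftFactor_ne_zero hT.weight_ne_zero n
    exact (Submodule.smul_mem_iff _ hn).1 (Submodule.subset_span ⟨n, rfl⟩)
  exact ⟨_, isVolterraModel_momentSeries (by rw [map_smul, hT.apply_zero, smul_zero])
    hT.apply_shiftFactor_smul_succ ha hsum hspan⟩

end IsBackwardWeightedShift

theorem corollary3_general [CompleteSpace X] (hT : IsBackwardWeightedShift e w T)
    (hw : ∃ c : ℝ, 0 < c ∧ ∀ n : ℕ, 1 ≤ n → c / (n : ℝ) ≤ ‖w n‖)
    (heK : ∃ K : ℝ, ∀ n, ‖e n‖ ≤ K) (he : Dense (Submodule.span 𝕜 (Set.range e) : Set X)) :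
    SatisfiesKitaiCriterion (ContinuousLinearMap.id 𝕜 X + T) := by
  obtain ⟨c, hc, hw⟩ := hw
  obtain ⟨K, heK⟩ := heK
  have hw' (n : ℕ) (hn : 1 ≤ n) : c / (n : ℝ) ≤ ‖(-w) n‖ := by
    rw [Pi.neg_apply, norm_neg]
    exact hw n hn
  obtain ⟨A, hA⟩ := hT.exists_isVolterraModel heK he (half_pos hc) (half_lt_self hc) hw
  obtain ⟨B, hB⟩ := hT.neg.exists_isVolterraModel heK he (half_pos hc) (half_lt_self hc) hw'
  exact hA.satisfiesKitaiCriterion hB (half_pos hc).le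

end WeightedShift

section SequenceSpaces

variable (𝕜 : Type*) [RCLike 𝕜]

theorem norm_lpBasis_le (p : ℝ≥0∞) [Fact (1 ≤ p)] (n : ℕ) : ‖lpBasis 𝕜 p n‖ ≤ 1 := by
  rw [lpBasis, lp.norm_single (zero_lt_one.trans_le Fact.out), norm_one]

theorem dense_span_lpBasis (p : ℝ≥0∞) [Fact (1 ≤ p)] (hp : p ≠ ∞) :
    Dense (Submodule.span 𝕜 (Set.range (lpBasis 𝕜 p)) : Set (lp (fun _ : ℕ => 𝕜) p)) := by
  intro x
  refine mem_closure_of_tendsto (lp.hasSum_single hp x) (Eventually.of_forall fun s =>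
    Submodule.sum_mem _ fun n _ => ?_)
  have hsingle : lp.single p n (x n) = x n • lpBasis 𝕜 p n := by
    rw [lpBasis, ← lp.single_smul, smul_eq_mul, mul_one]
  rw [hsingle]
  exact Submodule.smul_mem _ _ (Submodule.subset_span ⟨n, rfl⟩)

variable {𝕜}

theorem norm_zeroAtInfty_le {α E : Type*} [TopologicalSpace α] [SeminormedAddCommGroup E]
    {f : C₀(α, E)} {C : ℝ} (hC : 0 ≤ C) (h : ∀ t, ‖f t‖ ≤ C) : ‖f‖ ≤ C := by
  rw [← ZeroAtInftyContinuousMap.norm_toBCF_eq_norm]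
  exact (BoundedContinuousFunction.norm_le hC).2 h

theorem c0Basis_apply (n m : ℕ) : c0Basis 𝕜 n m = if m = n then 1 else 0 :=
  Pi.single_apply n 1 m

theorem sum_range_smul_c0Basis_apply (x : ℕ → 𝕜) (N m : ℕ) :
    (∑ n ∈ Finset.range N, x n • c0Basis 𝕜 n) m = if m < N then x m else 0 := by
  induction N with
  | zero => rfl
  | succ N ih =>
    rw [Finset.sum_range_succ, ZeroAtInftyContinuousMap.add_apply, ih,
      ZeroAtInftyContinuousMap.smul_apply, c0Basis_apply, smul_eq_mul]
    grind

variable (𝕜)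

theorem norm_c0Basis_le (n : ℕ) : ‖c0Basis 𝕜 n‖ ≤ 1 := by
  refine norm_zeroAtInfty_le zero_le_one fun m => ?_
  rw [c0Basis_apply]
  split_ifs <;> simp

theorem dense_span_c0Basis :
    Dense (Submodule.span 𝕜 (Set.range (c0Basis 𝕜)) : Set C₀(ℕ, 𝕜)) := by
  refine fun x => Metric.mem_closure_iff.2 fun ε hε => ?_
  have hx : Tendsto x atTop (𝓝 0) := by simpa using x.zero_at_infty'
  obtain ⟨N, hN⟩ := Metric.tendsto_atTop.1 hx (ε / 2) (half_pos hε)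
  refine ⟨∑ n ∈ Finset.range N, x n • c0Basis 𝕜 n, Submodule.sum_mem _ fun n _ =>
    Submodule.smul_mem _ _ (Submodule.subset_span ⟨n, rfl⟩), ?_⟩
  rw [dist_eq_norm]
  refine (norm_zeroAtInfty_le (half_pos hε).le fun m => ?_).trans_lt (half_lt_self hε)
  rw [ZeroAtInftyContinuousMap.sub_apply, sum_range_smul_c0Basis_apply]
  split_ifs with h
  · simpa using (half_pos hε).le
  · simpa using (hN m (not_lt.1 h)).le

end SequenceSpaces

theorem corollary3 {𝕜 : Type*} [RCLike 𝕜] (w : ℕ → 𝕜)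
    (hw : ∃ c : ℝ, 0 < c ∧ ∀ n : ℕ, 1 ≤ n → c / (n : ℝ) ≤ ‖w n‖) :
    (∀ (p : ℝ≥0∞) [Fact (1 ≤ p)], p ≠ ∞ →
      ∀ T : lp (fun _ : ℕ => 𝕜) p →L[𝕜] lp (fun _ : ℕ => 𝕜) p,
        IsBackwardWeightedShift (lpBasis 𝕜 p) w T →
          SatisfiesKitaiCriterion (ContinuousLinearMap.id 𝕜 (lp (fun _ : ℕ => 𝕜) p) + T)) ∧
    (∀ T : C₀(ℕ, 𝕜) →L[𝕜] C₀(ℕ, 𝕜),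
      IsBackwardWeightedShift (c0Basis 𝕜) w T →
        SatisfiesKitaiCriterion (ContinuousLinearMap.id 𝕜 C₀(ℕ, 𝕜) + T)) :=
  ⟨fun p _ hp _ hT =>
    corollary3_general hT hw ⟨1, norm_lpBasis_le 𝕜 p⟩ (dense_span_lpBasis 𝕜 p hp),
  fun _ hT => corollary3_general hT hw ⟨1, norm_c0Basis_le 𝕜⟩ (dense_span_c0Basis 𝕜)⟩
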